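/- Setting. Let $\mathcal S,\mathcal A$ be finite sets, $\mathcal A\neq\emptyset$, with $S=|\mathcal S|$, $A=|\mathcal A|$, and let $H$ be the horizon. For $h\in[H]=\{1,\dots,H\}$ let $P_h(\cdot\mid s,a)$ be a probability distribution on $\mathcal S$ and $R_h(\cdot\mid s,a)$ a probability distribution on $[0,1]$ that has a density. Let $U:[0,H]\to\mathbb R$ be continuous and strictly increasing. A Markovian policy is a family $\pi=(\pi_h)_{h\in[H]}$ of measurable maps $\pi_h:\mathcal S\times[0,h-1]\to\mathcal A$. Its value function is $$V_h^\pi(s,y)=\mathbb E^\pi\Big[U\Big(y+\sum_{h'=h}^H r_{h'}\Big)\,\Big|\,s_h=s,\ y_h=y\Big],$$ where $a_{h'}=\pi_{h'}(s_{h'},y_{h'})$, the next state $s_{h'+1}\sim P_{h'}(\cdot\mid s_{h'},a_{h'})$ and the reward $r_{h'}\sim R_{h'}(\cdot\mid s_{h'},a_{h'})$ are drawn independently, and $y_{h'+1}=y_{h'}+r_{h'}$. A Markovian policy $\pi^*$ is optimal if $V_h^{\pi^*}(s,y)\ge V_h^{\pi}(s,y)$ for all Markovian $\pi$, all $h\in[H]$,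 $s\in\mathcal S$ and $y\in[0,h-1]$. Algorithm (VIGU). Fix $\epsilon_o>0$ and an integer $n\ge1$. For $c\ge0$ let $G(c)=\{0,\epsilon_o,2\epsilon_o,\dots,\lfloor c/\epsilon_o\rfloor\epsilon_o\}$, and let $\mathrm{Proj}_{G(c)}(x)$ be the point of $G(c)$ nearest to $x$, the smaller one in case of a tie. For every $(s,a,h)\in\mathcal S\times\mathcal A\times[H]$ draw $n$ i.i.d. samples $(s^i,r^i)\sim P_h(\cdot\mid s,a)\otimes R_h(\cdot\mid s,a)$, independently over all $(s,a,h)$, and put $$\hat P_h(s'\mid s,a)=\frac1n\sum_{i=1}^n\mathbf 1\{s^i=s'\},\qquad \hat R_h(r\mid s,a)=\frac1n\sum_{i=1}^n\mathbf 1\{\mathrm{Proj}_{G(1)}(r^i)=r\}\quad(r\in G(1)).$$ Set $\hat V_{H+1}(s,y)=U(y)$ and, for $h=H,\dots,1$ and $y\in G(h-1)$, $$\hat Q_h(s,y,a)=\sum_{s'\in\mathcal S}\sum_{r\in G(1)}\hat P_h(s'\mid s,a)\,\hat R_h(r\mid s,a)\,\hat V_{h+1}(s',y+r),\qquad \hat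 V_h(s,y)=\max_{a}\hat Q_h(s,y,a),$$ and choose $\hat\pi_h(s,y)\in\arg\max_a\hat Q_h(s,y,a)$ (ties broken arbitrarily). The output is the Markovian policy $\Gamma(\hat\pi)_h(s,y)=\hat\pi_h\big(s,\mathrm{Proj}_{G(h-1)}(y)\big)$. Theorem. There is a universal constant $C>0$ such that the following holds for every such model, algorithm parameters $\epsilon_o>0$, $n\ge1$, and $0<p<1$. If $U$ is $\kappa$-Lipschitz on $[0,H]$ and $\pi^*$ is an optimal Markovian policy, then with probability at least $1-p$, for every $h\in[H]$, $$\sup_{s\in\mathcal S,\ y\in[0,h-1]}\big|V_h^{\pi^*}(s,y)-V_h^{\Gamma(\hat\pi)}(s,y)\big|\le C\Big(H\kappa\epsilon_o+H^3\kappa\sqrt{\frac{\iota_1}{n}}\Big),\qquad \iota_1=\log\Big(\frac{4H^2SA}{p\,\epsilon_o}\Big),$$ where the square root is read as $0$ in the degenerate case $\iota_1<0$ of a very coarse net. -/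

import Mathlib

open MeasureTheory ProbabilityTheory Set
open scoped ENNReal NNReal

universe u v w

noncomputable section

/-- A finite-horizon risk-sensitive MDP with horizon `H`, transition kernels `P h`, reward
distributions `R h` on `[0,1]` possessing a density, and a continuous strictly increasing utility
function `U` on `[0,H]`.  Only the stages `h = 1, …, H` and the values of `U` on `[0,H]` matter. -/
structure RSMDP (S : Type u) (A : Type v) [MeasurableSpace S] (H : ℕ) where
  P : ℕ → S → A → Measure S
  R : ℕ → S → A → Measure ℝ
  U : ℝ → ℝ
  isProb_P : ∀ h s a, IsProbabilityMeasure (P h s a)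
  isProb_R : ∀ h s a, IsProbabilityMeasure (R h s a)
  reward_mem : ∀ h s a, R h s a (Icc (0 : ℝ) 1)ᶜ = 0
  reward_density : ∀ h s a, R h s a ≪ volume
  continuous_U : ContinuousOn U (Icc (0 : ℝ) H)
  strictMono_U : StrictMonoOn U (Icc (0 : ℝ) H)

/-- A deterministic Markovian policy on the enlarged state space: at stage `h` the action depends
on the state and on the reward accumulated so far. Only `y ∈ [0, h - 1]` matters. -/
structure MarkovPolicy (S : Type u) (A : Type v) [MeasurableSpace S] [MeasurableSpace A] where
  act : ℕ → S × ℝ → A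
  measurable_act : ∀ h, Measurable (act h)

section Model

variable {S : Type u} {A : Type v} [Fintype S] [MeasurableSpace S] [DiscreteMeasurableSpace S]
  [Fintype A] [MeasurableSpace A] [DiscreteMeasurableSpace A] {H : ℕ}

/-- The joint law of the next state and the reward given a state-action pair at stage `h`. -/
def envKernel (M : RSMDP S A H) (h : ℕ) : Kernel (S × A) (S × ℝ) :=
  Kernel.ofFunOfCountable fun x => (M.P h x.1 x.2).prod (M.R h x.1 x.2)

/-- The joint law of the next state and the reward at stage `h` from the enlarged state `(s, y)`
when the action is chosen by the policy `π`. -/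
def stepKernel (M : RSMDP S A H) (π : MarkovPolicy S A) (h : ℕ) : Kernel (S × ℝ) (S × ℝ) :=
  (envKernel M h).comap (fun x => (x.1, π.act h x))
    (measurable_fst.prodMk (π.measurable_act h))

/-- The law of the trajectory `((s_{h+1}, r_h), …, (s_{h+k}, r_{h+k-1}))` of `k` steps under `π`,
started at stage `h` in the enlarged state `(s_h, y_h)`. -/
def trajLaw (M : RSMDP S A H) (π : MarkovPolicy S A) :
    (k : ℕ) → (h : ℕ) → Kernel (S × ℝ) (Fin k → S × ℝ)
  | 0, _ => Kernel.const _ (Measure.dirac Fin.elim0)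
  | k + 1, h =>
      ((stepKernel M π h) ⊗ₖ
        ((trajLaw M π k (h + 1)).comap
          (fun x : (S × ℝ) × (S × ℝ) => (x.2.1, x.1.2 + x.2.2)) (by fun_prop))).map
        (fun x => (Fin.cons x.1 x.2 : Fin (k + 1) → S × ℝ))

/-- The value function `V_h^π(s, y)`: the expected utility of `y + r_h + ⋯ + r_H`. -/
def value (M : RSMDP S A H) (π : MarkovPolicy S A) (h : ℕ) (s : S) (y : ℝ) : ℝ :=
  ∫ ω, M.U (y + ∑ i, (ω i).2) ∂(trajLaw M π (H + 1 - h) h (s, y))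

/-- `π` is an optimal Markovian policy: it maximizes the value function at every stage and every
enlarged state. -/
def IsOptimalPolicy (M : RSMDP S A H) (π : MarkovPolicy S A) : Prop :=
  ∀ h ∈ Icc 1 H, ∀ s : S, ∀ y ∈ Icc (0 : ℝ) (h - 1), ∀ π' : MarkovPolicy S A,
    value M π' h s y ≤ value M π h s y

/-- `sup_{s, y} |V_h^π(s, y) - V_h^π'(s, y)|` over `s ∈ S` and `y ∈ [0, h - 1]`. -/
def valueDist (M : RSMDP S A H) (π π' : MarkovPolicy S A) (h : ℕ) : ℝ≥0∞ :=
  ⨆ (s : S) (y : ℝ) (_ : y ∈ Icc (0 : ℝ) (h - 1)),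
    ENNReal.ofReal |value M π h s y - value M π' h s y|

end Model

section Grid

/-- The covering net `{0, ε, 2ε, …, ⌊c/ε⌋ε}` of `[0, c]`. -/
def grid (ε c : ℝ) : Finset ℝ :=
  (Finset.range (⌊c / ε⌋₊ + 1)).image fun k : ℕ => (k : ℝ) * ε

/-- The point of `grid ε c` nearest to `y`, the smaller one if there are two. -/
def gridProj (ε c y : ℝ) : ℝ :=
  ((min ⌈y / ε - 1 / 2⌉₊ ⌊c / ε⌋₊ : ℕ) : ℝ) * ε

theorem gridProj_mem (ε c y : ℝ) : gridProj ε c y ∈ grid ε c := by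
  refine Finset.mem_image.2 ⟨_, Finset.mem_range.2 ?_, rfl⟩
  exact Nat.lt_succ_of_le (min_le_right _ _)

theorem measurable_gridProj (ε c : ℝ) : Measurable (gridProj ε c) := by
  unfold gridProj
  have h1 : Measurable fun y : ℝ => ⌈y / ε - 1 / 2⌉₊ :=
    Nat.measurable_ceil.comp (by fun_prop)
  have h2 : Measurable fun m : ℕ => ((min m ⌊c / ε⌋₊ : ℕ) : ℝ) * ε := measurable_of_countable _
  exact h2.comp h1

/-- `gridProj ε c y` is a nearest point of the net, and the smallest of the nearest points. -/
theorem gridProj_spec {ε : ℝ} (hε : 0 < ε) (c y : ℝ) {z : ℝ} (hz : z ∈ grid ε c) :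
    |y - gridProj ε c y| ≤ |y - z| ∧ (|y - gridProj ε c y| = |y - z| → gridProj ε c y ≤ z) := by
  obtain ⟨j, hj, rfl⟩ := Finset.mem_image.1 hz
  have hjN : j ≤ ⌊c / ε⌋₊ := Nat.lt_succ_iff.1 (Finset.mem_range.1 hj)
  have hy : y = y / ε * ε := by field_simp
  set t := y / ε with ht
  set m := min ⌈t - 1 / 2⌉₊ ⌊c / ε⌋₊ with hm
  have hg : gridProj ε c y = (m : ℝ) * ε := rfl
  have key : |t - m| ≤ |t - j| ∧ (|t - m| = |t - j| → m ≤ j) := by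
    rcases lt_trichotomy m j with h | h | h
    · have hc : ⌈t - 1 / 2⌉₊ ≤ m := by
        by_contra hcon
        omega
      have h1 : t - 1 / 2 ≤ m := Nat.ceil_le.1 hc
      have h2 : (m : ℝ) + 1 ≤ j := by exact_mod_cast h
      refine ⟨?_, fun _ => h.le⟩
      rw [abs_sub_comm t j, abs_of_nonneg (show (0 : ℝ) ≤ j - t by linarith)]
      exact abs_le.2 ⟨by linarith, by linarith⟩
    · subst h
      exact ⟨le_rfl, fun _ => le_rfl⟩
    · have hc : j < ⌈t - 1 / 2⌉₊ := lt_of_lt_of_le h (min_le_left _ _)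
      have h2 : (j : ℝ) + 1 ≤ m := by exact_mod_cast h
      have h3 : (m : ℝ) < t + 1 / 2 := by
        have hp : 0 < t - 1 / 2 := by
          by_contra hn
          push Not at hn
          rw [Nat.ceil_eq_zero.2 hn] at hc
          omega
        have := Nat.ceil_lt_add_one hp.le
        have h4 : (m : ℝ) ≤ (⌈t - 1 / 2⌉₊ : ℝ) := by exact_mod_cast min_le_left _ _
        linarith
      have : |t - m| < |t - j| := by
        rw [abs_of_nonneg (show (0 : ℝ) ≤ t - j by linarith)]
        exact abs_lt.2 ⟨by linarith, by linarith⟩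
      exact ⟨this.le, fun h' => absurd h' this.ne⟩
  have e : ∀ q : ℝ, |y - q * ε| = |t - q| * ε := fun q => by
    rw [show y - q * ε = (t - q) * ε by rw [sub_mul, ← hy], abs_mul, abs_of_pos hε]
  rw [hg, e, e]
  refine ⟨mul_le_mul_of_nonneg_right key.1 hε.le, fun h' => ?_⟩
  have : m ≤ j := key.2 (mul_right_cancel₀ hε.ne' h')
  exact mul_le_mul_of_nonneg_right (by exact_mod_cast this) hε.le

/-- A policy on the covering nets: at stage `h` it is defined on `S × grid ε (h - 1)`. -/
def GridPolicy (S : Type u) (A : Type v) (ε : ℝ) : Type (max u v) :=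
  (h : ℕ) → S → {y : ℝ // y ∈ grid ε ((h : ℝ) - 1)} → A

/-- Policy interpolation: act at `(s, y)` as the net policy acts at `(s, Proj y)`. -/
def interpolate {S : Type u} {A : Type v} [Fintype S] [MeasurableSpace S]
    [DiscreteMeasurableSpace S] [MeasurableSpace A] {ε : ℝ} (π : GridPolicy S A ε) :
    MarkovPolicy S A where
  act h x := π h x.1 ⟨gridProj ε (h - 1) x.2, gridProj_mem _ _ _⟩
  measurable_act h := by
    have h1 : Measurable fun x : S × ℝ =>
        (x.1, (⟨gridProj ε (h - 1) x.2, gridProj_mem _ _ _⟩ :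
          {y : ℝ // y ∈ grid ε ((h : ℝ) - 1)})) :=
      measurable_fst.prodMk
        (((measurable_gridProj ε (h - 1)).comp measurable_snd).subtype_mk)
    have h2 : Measurable fun q : S × {y : ℝ // y ∈ grid ε ((h : ℝ) - 1)} => π h q.1 q.2 :=
      measurable_of_countable _
    exact h2.comp h1

end Grid

section Algorithm

variable {S : Type u} {A : Type v} {n : ℕ}

/-- The table of simulator outputs: `D s a h i` is the `i`-th sample `(s', r)` at `(s, a, h)`. -/
abbrev SampleTable (S : Type u) (A : Type v) (n : ℕ) : Type (max u v) :=
  S → A → ℕ → Fin n → S × ℝ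

/-- The empirical transition probability of `s'` at `(s, a, h)`. -/
def empP (D : SampleTable S A n) (h : ℕ) (s : S) (a : A) (s' : S) : ℝ :=
  (∑ i : Fin n, ({s'} : Set S).indicator (fun _ => (1 : ℝ)) (D s a h i).1) / n

/-- The empirical probability of the projected reward `r` at `(s, a, h)`. -/
def empR (ε : ℝ) (D : SampleTable S A n) (h : ℕ) (s : S) (a : A) (r : ℝ) : ℝ :=
  (∑ i : Fin n, ({r} : Set ℝ).indicator (fun _ => (1 : ℝ)) (gridProj ε 1 (D s a h i).2)) / n

/-- One backup: the expectation of `V (s', y + r)` for `s'` and `r` drawn independently from the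
empirical distributions at `(s, a, h)`. -/
def backup [Fintype S] (ε : ℝ) (D : SampleTable S A n) (h : ℕ) (V : S → ℝ → ℝ)
    (s : S) (y : ℝ) (a : A) : ℝ :=
  ∑ s' : S, ∑ r ∈ grid ε 1, empP D h s a s' * empR ε D h s a r * V s' (y + r)

/-- Value iteration with `k` stages to go, that is, the estimate at stage `H + 1 - k`. -/
def viguIter [Fintype S] [Fintype A] [Nonempty A] (U : ℝ → ℝ) (H : ℕ) (ε : ℝ)
    (D : SampleTable S A n) : ℕ → S → ℝ → ℝ
  | 0 => fun _ y => U y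
  | k + 1 => fun s y => Finset.univ.sup' Finset.univ_nonempty
      (backup ε D (H - k) (viguIter U H ε D k) s y)

/-- The estimated value function at stage `h`. -/
def viguV [Fintype S] [Fintype A] [Nonempty A] (U : ℝ → ℝ) (H : ℕ) (ε : ℝ)
    (D : SampleTable S A n) (h : ℕ) : S → ℝ → ℝ :=
  viguIter U H ε D (H + 1 - h)

/-- The estimated Q function at stage `h`. -/
def viguQ [Fintype S] [Fintype A] [Nonempty A] (U : ℝ → ℝ) (H : ℕ) (ε : ℝ)
    (D : SampleTable S A n) (h : ℕ) : S → ℝ → A → ℝ :=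
  backup ε D h (viguV U H ε D (h + 1))

/-- The recursion carried out by the algorithm. -/
theorem viguV_eq [Fintype S] [Fintype A] [Nonempty A] (U : ℝ → ℝ) (H : ℕ) (ε : ℝ)
    (D : SampleTable S A n) {h : ℕ} (hh : h ∈ Icc 1 H) (s : S) (y : ℝ) :
    viguV U H ε D h s y =
      Finset.univ.sup' Finset.univ_nonempty (viguQ U H ε D h s y) := by
  obtain ⟨h1, h2⟩ := hh
  have e1 : H + 1 - h = (H - h) + 1 := by omega
  have e2 : H - (H - h) = h := by omega
  have e3 : H + 1 - (h + 1) = H - h := by omega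
  simp only [viguV, viguQ, e1, e3, viguIter, e2]

/-- `π` is a possible result of the value iteration on the samples `D`: at every stage and net
point its action is a maximizer of the estimated Q function, ties being broken in any way. -/
def IsVIGUPolicy [Fintype S] [Fintype A] [Nonempty A] (U : ℝ → ℝ) (H : ℕ) {ε : ℝ}
    (D : SampleTable S A n) (π : GridPolicy S A ε) : Prop :=
  ∀ h ∈ Icc 1 H, ∀ (s : S) (y : {y : ℝ // y ∈ grid ε ((h : ℝ) - 1)}) (a : A),
    viguQ U H ε D h s y a ≤ viguQ U H ε D h s y (π h s y)

/-- The random table `X` is produced by querying the simulator `n` times at every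
`(s, a, h)` with `1 ≤ h ≤ H`: all samples are independent, and at `(s, a, h)` the pair `(s', r)`
has law `P_h(· | s, a) ⊗ R_h(· | s, a)`. -/
structure IsSimulated {H : ℕ} [MeasurableSpace S] (M : RSMDP S A H) {Ω : Type w}
    [MeasurableSpace Ω] (μ : Measure Ω) (X : S → A → ℕ → Fin n → Ω → S × ℝ) : Prop where
  measurable : ∀ s a, ∀ h ∈ Icc 1 H, ∀ i, Measurable (X s a h i)
  law : ∀ s a, ∀ h ∈ Icc 1 H, ∀ i, μ.map (X s a h i) = (M.P h s a).prod (M.R h s a)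
  indep : iIndepFun (fun (q : S × A × (Icc 1 H : Set ℕ) × Fin n) =>
    X q.1 q.2.1 q.2.2.1 q.2.2.2) μ

end Algorithm

end

/-! The analysis passes through the model in which every reward is rounded to the net. Its exact
values `projectedIter` are deterministic, Lipschitz in the accumulated reward, and confined to an
interval of length `κ * H`. Estimating their backups therefore needs no conditioning on the samples
of other stages. Adding a rounded reward to a net point of one stage gives a net point of the next,
so a union bound over at most `H² S A / ε` backups is enough.

Statistical part (`measure_product_empirical_ge_le`): an empirical backup integrates against the
product of two empirical marginals, so it averages over all pairs `(i, j)` of samples, and these are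
dependent. The pairs split into the `n` cyclic shifts `(i, i + k)`. Since state and reward are
independent, each shift is again an i.i.d. family. Averaging the shifts keeps the sub-Gaussian
constant of one of them, which gives Hoeffding's bound for `n` samples.

Deterministic part (`abs_value_sub_le`): suppose all backups are accurate within `δ`. The optimal
value is at most the exact dynamic programming value, which rounding changes by at most `κ ε` per
stage; that this value is attained is not needed. The interpolated greedy policy departs from
`projectedIter` by at most `3 κ ε + 2 H δ` per stage, plus one initial rounding
(`abs_expectedUtility_interpolate_sub_le`). Taking `δ = κ H √(ι₁ / n)` gives the rate. -/

set_option linter.unusedSectionVars false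

noncomputable section

/-! ### Hoeffding's inequality for a product of empirical marginals -/

section Concentration

/-- Permuting the second components preserves the law of an i.i.d. family of independent pairs. -/
theorem measurePreserving_permute_snd {α β ι : Type*} [MeasurableSpace α] [MeasurableSpace β]
    [Fintype ι] (P : Measure α) (Q : Measure β) [SigmaFinite P] [SigmaFinite Q]
    (σ : Equiv.Perm ι) :
    MeasurePreserving (fun (x : ι → α × β) i => ((x i).1, (x (σ i)).2))
      (Measure.pi fun _ => P.prod Q) (Measure.pi fun _ => P.prod Q) := by
  have h1 := measurePreserving_arrowProdEquivProdArrow α β ι (fun _ => P) (fun _ => Q)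
  have h2 := (measurePreserving_piCongrLeft (α := fun _ : ι => β) (fun _ => Q) σ).symm
  have h3 := (MeasurePreserving.id (Measure.pi fun _ : ι => P)).prod h2
  exact (h1.symm.comp h3).comp h1

/-- The joint law of the family is a power of `P.prod Q`, and re-pairing the coordinates preserves
that power. The independence of the two components of a sample enters here. -/
theorem iIndepFun_permute_snd {Ω α β ι : Type*} [MeasurableSpace Ω] [MeasurableSpace α]
    [MeasurableSpace β] [Fintype ι] {μ : Measure Ω} [IsProbabilityMeasure μ]
    {P : Measure α} {Q : Measure β} [IsProbabilityMeasure P] [IsProbabilityMeasure Q]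
    {X : ι → Ω → α × β} (hX : ∀ i, Measurable (X i)) (hlaw : ∀ i, μ.map (X i) = P.prod Q)
    (hind : iIndepFun X μ) (σ : Equiv.Perm ι) :
    iIndepFun (fun i ω => ((X i ω).1, (X (σ i) ω).2)) μ ∧
      ∀ i, μ.map (fun ω => ((X i ω).1, (X (σ i) ω).2)) = P.prod Q := by
  have hm : ∀ i, Measurable (fun ω => ((X i ω).1, (X (σ i) ω).2)) := fun i =>
    (measurable_fst.comp (hX i)).prodMk (measurable_snd.comp (hX (σ i)))
  have hpi : Measurable (fun ω i => X i ω) := measurable_pi_lambda _ hX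
  have hT := measurePreserving_permute_snd P Q σ
  have hlawX := (iIndepFun_iff_map_fun_eq_pi_map (fun i => (hX i).aemeasurable)).1 hind
  simp only [hlaw] at hlawX
  have hY : μ.map (fun ω i => ((X i ω).1, (X (σ i) ω).2)) = Measure.pi fun _ => P.prod Q := by
    rw [← hT.map_eq, ← hlawX, Measure.map_map hT.measurable hpi]
    rfl
  have hYi : ∀ i, μ.map (fun ω => ((X i ω).1, (X (σ i) ω).2)) = P.prod Q := by
    intro i
    have h := (measurePreserving_eval (fun _ : ι => P.prod Q) i).map_eq
    rw [← hY, Measure.map_map (measurable_pi_apply i) (measurable_pi_lambda _ hm)] at h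
    exact h
  refine ⟨?_, hYi⟩
  rw [iIndepFun_iff_map_fun_eq_pi_map (fun i => (hm i).aemeasurable), hY]
  simp only [hYi]

/-- A sum of sub-Gaussian variables, with no independence assumption. -/
theorem hasSubgaussianMGF_sum {Ω ι : Type*} [MeasurableSpace Ω] {μ : Measure Ω}
    [IsProbabilityMeasure μ] {Y : ι → Ω → ℝ} {c : ℝ≥0} (s : Finset ι)
    (hY : ∀ i ∈ s, HasSubgaussianMGF (Y i) c μ) :
    HasSubgaussianMGF (fun ω => ∑ i ∈ s, Y i ω) ((s.card : ℝ≥0) ^ 2 * c) μ := by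
  classical
  induction s using Finset.induction_on with
  | empty => simp
  | insert i s his ih =>
    have h := (hY i (Finset.mem_insert_self _ _)).add
      (ih fun j hj => hY j (Finset.mem_insert_of_mem hj))
    simp only [Finset.sum_insert his, Finset.card_insert_of_notMem his]
    convert h using 1
    -- Without independence, square roots of variance proxies add; a square root of `c` turns this
    -- into a polynomial identity.
    obtain ⟨r, rfl⟩ : ∃ r : ℝ≥0, c = r ^ 2 := ⟨NNReal.sqrt c, (NNReal.sq_sqrt c).symm⟩
    rw [NNReal.sqrt_mul, NNReal.sqrt_sq, NNReal.sqrt_sq]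
    push_cast
    ring

theorem sum_sum_shift {n : ℕ} [NeZero n] (g : Fin n → Fin n → ℝ) :
    ∑ k, ∑ i, g i (i + k) = ∑ i, ∑ j, g i j := by
  rw [Finset.sum_comm]
  exact Finset.sum_congr rfl fun i _ => Equiv.sum_comp (Equiv.addLeft i) (g i)

/-- Hoeffding's inequality for the expectation of a bounded function under the product of the two
marginal empirical measures. -/
theorem measure_product_empirical_ge_le {Ω α β : Type*} [MeasurableSpace Ω] [MeasurableSpace α]
    [MeasurableSpace β] {n : ℕ} (hn : 1 ≤ n) {μ : Measure Ω} [IsProbabilityMeasure μ]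
    {P : Measure α} {Q : Measure β} [IsProbabilityMeasure P] [IsProbabilityMeasure Q]
    {X : Fin n → Ω → α × β} (hX : ∀ i, Measurable (X i)) (hlaw : ∀ i, μ.map (X i) = P.prod Q)
    (hind : iIndepFun X μ) {f : α × β → ℝ} (hf : Measurable f) {a b : ℝ}
    (hab : ∀ x, f x ∈ Icc a b) {t : ℝ} (ht : 0 ≤ t) :
    μ.real {ω | t ≤ |(∑ i, ∑ j, f ((X i ω).1, (X j ω).2)) / (n : ℝ) ^ 2 - ∫ x, f x ∂P.prod Q|}
      ≤ 2 * Real.exp (-(2 * n * t ^ 2 / (b - a) ^ 2)) := by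
  have : NeZero n := ⟨by omega⟩
  have hn0 : (0 : ℝ) < n := by exact_mod_cast hn
  set e := ∫ x, f x ∂P.prod Q with he
  set c : ℝ≥0 := (‖b - a‖₊ / 2) ^ 2 with hc
  -- For fixed `k` the pairs `(i, i + k)` use each state and each reward exactly once, so the
  -- summands are independent.
  have hsub : ∀ k : Fin n, HasSubgaussianMGF
      (fun ω => ∑ i, (f ((X i ω).1, (X (i + k) ω).2) - e)) (n * c) μ := by
    intro k
    obtain ⟨hi, hl⟩ := iIndepFun_permute_snd hX hlaw hind (Equiv.addRight k)
    have hm : ∀ i, Measurable (fun ω => ((X i ω).1, (X (Equiv.addRight k i) ω).2)) := fun i =>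
      (measurable_fst.comp (hX i)).prodMk (measurable_snd.comp (hX (Equiv.addRight k i)))
    have hmean : ∀ i, ∫ ω, f ((X i ω).1, (X (Equiv.addRight k i) ω).2) ∂μ = e := by
      intro i
      rw [he, ← hl i, integral_map (hm i).aemeasurable hf.aestronglyMeasurable]
    have h := HasSubgaussianMGF.sum_of_iIndepFun (s := Finset.univ) (c := fun _ => c)
      (hi.comp (fun _ x => f x - e) fun _ => hf.sub_const e) (fun i _ => by
        have := hasSubgaussianMGF_of_mem_Icc (μ := μ) (a := a) (b := b)
          (X := fun ω => f ((X i ω).1, (X (Equiv.addRight k i) ω).2))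
          (hf.comp (hm i)).aemeasurable (ae_of_all _ fun ω => hab _)
        rw [hmean i] at this
        exact this)
    simpa using h
  have hsum := hasSubgaussianMGF_sum Finset.univ fun k _ => hsub k
  have hval : ∀ ω, ∑ i, ∑ j, (f ((X i ω).1, (X j ω).2) - e)
      = (n : ℝ) ^ 2 * ((∑ i, ∑ j, f ((X i ω).1, (X j ω).2)) / (n : ℝ) ^ 2 - e) := by
    intro ω
    rw [mul_sub, mul_div_cancel₀ _ (by positivity)]
    simp [Finset.sum_sub_distrib]
    ring
  have hshift : ∀ ω, ∑ k, ∑ i, (f ((X i ω).1, (X (i + k) ω).2) - e)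
      = (n : ℝ) ^ 2 * ((∑ i, ∑ j, f ((X i ω).1, (X j ω).2)) / (n : ℝ) ^ 2 - e) := fun ω =>
    (sum_sum_shift fun i j => f ((X i ω).1, (X j ω).2) - e).trans (hval ω)
  simp only [hshift] at hsum
  -- The `n` shifts, each with proxy `n * c`, give the proxy `n ^ 3 * c` at deviation `n ^ 2 * t`.
  -- The quotient is Hoeffding's exponent for `n` samples. If `a = b`, both sides are `0` because
  -- division by zero gives zero.
  have hexp : -((n : ℝ) ^ 2 * t) ^ 2 /
      (2 * (((Finset.univ : Finset (Fin n)).card : ℝ≥0) ^ 2 * (n * c) : ℝ≥0))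
      = -(2 * n * t ^ 2 / (b - a) ^ 2) := by
    have hc' : (c : ℝ) = (b - a) ^ 2 / 4 := by
      simp [hc, div_pow]; norm_num
    push_cast
    rw [hc', Finset.card_univ, Fintype.card_fin]
    rcases eq_or_ne (b - a) 0 with h0 | h0
    · simp [h0]
    · field_simp
      ring
  have hpos : (0 : ℝ) ≤ (n : ℝ) ^ 2 * t := by positivity
  have h1 := hsum.measure_ge_le hpos
  have h2 := hsum.neg.measure_ge_le hpos
  rw [hexp] at h1 h2
  refine le_trans ?_ ((add_le_add h1 h2).trans_eq (two_mul _).symm)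
  refine (measureReal_mono ?_).trans (measureReal_union_le _ _)
  intro ω hω
  have hn2 : (0 : ℝ) < (n : ℝ) ^ 2 := by positivity
  rcases le_abs.1 (mem_ofPred_eq ▸ hω) with h | h
  · exact Or.inl (mul_le_mul_of_nonneg_left h hn2.le)
  · refine Or.inr ?_
    simp only [mem_ofPred_eq, Pi.neg_apply, ← mul_neg]
    exact mul_le_mul_of_nonneg_left h hn2.le

end Concentration

/-! ### Integral and supremum estimates, regular value functions -/

section Auxiliary

theorem abs_integral_sub_integral_le {α : Type*} [MeasurableSpace α] {μ : Measure α}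
    [IsProbabilityMeasure μ] {f g : α → ℝ} (hf : Integrable f μ) (hg : Integrable g μ) {c : ℝ}
    (h : ∀ᵐ x ∂μ, |f x - g x| ≤ c) : |∫ x, f x ∂μ - ∫ x, g x ∂μ| ≤ c := by
  rw [← integral_sub hf hg]
  simpa using norm_integral_le_of_norm_le_const (f := fun x => f x - g x) h

theorem integral_mem_Icc {α : Type*} [MeasurableSpace α] {μ : Measure α}
    [IsProbabilityMeasure μ] {f : α → ℝ} (hf : Measurable f) {a b : ℝ}
    (h : ∀ x, f x ∈ Icc a b) : ∫ x, f x ∂μ ∈ Icc a b := by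
  have hi : Integrable f μ := Integrable.of_mem_Icc a b hf.aemeasurable (ae_of_all _ h)
  constructor
  · simpa using integral_mono (integrable_const a) hi fun x => (h x).1
  · simpa using integral_mono hi (integrable_const b) fun x => (h x).2

theorem abs_sup'_sub_sup'_le {ι : Type*} {s : Finset ι} (hs : s.Nonempty) {f g : ι → ℝ} {c : ℝ}
    (h : ∀ i ∈ s, |f i - g i| ≤ c) : |s.sup' hs f - s.sup' hs g| ≤ c := by
  refine abs_sub_le_iff.2 ⟨?_, ?_⟩
  · rw [sub_le_iff_le_add]
    refine Finset.sup'_le _ _ fun i hi => ?_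
    linarith [(abs_le.1 (h i hi)).2, Finset.le_sup' g hi]
  · rw [sub_le_iff_le_add]
    refine Finset.sup'_le _ _ fun i hi => ?_
    linarith [(abs_le.1 (h i hi)).1, Finset.le_sup' f hi]

/-- A family of functions of the accumulated reward that are uniformly Lipschitz and bounded. -/
structure IsRegularValue {S : Type u} (κ : ℝ≥0) (m b : ℝ) (V : S → ℝ → ℝ) : Prop where
  lipschitz : ∀ s, LipschitzWith κ (V s)
  mem : ∀ s y, V s y ∈ Icc m b

namespace IsRegularValue

variable {S : Type u} {κ : ℝ≥0} {m b : ℝ} {V : S → ℝ → ℝ}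

theorem abs_sub_le (hV : IsRegularValue κ m b V) (s : S) (y y' : ℝ) :
    |V s y - V s y'| ≤ κ * |y - y'| := by
  simpa [Real.dist_eq] using (hV.lipschitz s).dist_le_mul y y'

theorem measurable [Fintype S] [MeasurableSpace S] [DiscreteMeasurableSpace S]
    (hV : IsRegularValue κ m b V) : Measurable fun z : S × ℝ => V z.1 z.2 :=
  measurable_from_prod_countable_right fun s => (hV.lipschitz s).continuous.measurable

end IsRegularValue

end Auxiliary

/-! ### The Bellman recursion for a fixed policy -/

section ValueRecursion

variable {S : Type u} {A : Type v} [Fintype S] [MeasurableSpace S] [DiscreteMeasurableSpace S]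
  [Fintype A] [MeasurableSpace A] [DiscreteMeasurableSpace A] {H : ℕ}

/-- The joint law of the next state and the reward at `(s, a)` in stage `h`. -/
def envLaw (M : RSMDP S A H) (h : ℕ) (s : S) (a : A) : Measure (S × ℝ) :=
  (M.P h s a).prod (M.R h s a)

instance isProbabilityMeasure_envLaw (M : RSMDP S A H) (h : ℕ) (s : S) (a : A) :
    IsProbabilityMeasure (envLaw M h s a) := by
  have := M.isProb_P h s a
  have := M.isProb_R h s a
  unfold envLaw
  infer_instance

theorem ae_envLaw_reward_mem (M : RSMDP S A H) (h : ℕ) (s : S) (a : A) :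
    ∀ᵐ z ∂envLaw M h s a, z.2 ∈ Icc (0 : ℝ) 1 := by
  have := M.isProb_P h s a
  have := M.isProb_R h s a
  have h1 : ∀ᵐ r ∂M.R h s a, r ∈ Icc (0 : ℝ) 1 := M.reward_mem h s a
  exact Measure.quasiMeasurePreserving_snd.ae h1

instance isMarkovKernel_envKernel (M : RSMDP S A H) (h : ℕ) : IsMarkovKernel (envKernel M h) :=
  ⟨fun x => isProbabilityMeasure_envLaw M h x.1 x.2⟩

instance isMarkovKernel_stepKernel (M : RSMDP S A H) (π : MarkovPolicy S A) (h : ℕ) :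
    IsMarkovKernel (stepKernel M π h) := by
  unfold stepKernel
  infer_instance

theorem stepKernel_apply (M : RSMDP S A H) (π : MarkovPolicy S A) (h : ℕ) (x : S × ℝ) :
    stepKernel M π h x = envLaw M h x.1 (π.act h x) := rfl

theorem measurable_finCons {α : Type*} [MeasurableSpace α] (k : ℕ) :
    Measurable fun x : α × (Fin k → α) => (Fin.cons x.1 x.2 : Fin (k + 1) → α) := by
  refine measurable_pi_iff.2 fun i => ?_
  refine Fin.cases ?_ (fun j => ?_) i
  · simpa using measurable_fst
  · simp only [Fin.cons_succ]
    exact (measurable_pi_apply j).comp measurable_snd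

instance isMarkovKernel_trajLaw (M : RSMDP S A H) (π : MarkovPolicy S A) (k h : ℕ) :
    IsMarkovKernel (trajLaw M π k h) := by
  induction k generalizing h with
  | zero => unfold trajLaw; infer_instance
  | succ k ih =>
    have := ih (h + 1)
    unfold trajLaw
    exact Kernel.IsMarkovKernel.map _ (measurable_finCons k)

theorem ae_trajLaw_reward_mem (M : RSMDP S A H) (π : MarkovPolicy S A) (k h : ℕ) (x : S × ℝ) :
    ∀ᵐ ω ∂trajLaw M π k h x, ∀ i, (ω i).2 ∈ Icc (0 : ℝ) 1 := by
  induction k generalizing h x with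
  | zero => exact ae_of_all _ fun ω i => i.elim0
  | succ k ih =>
    have hset : ∀ j, MeasurableSet {ω : Fin j → S × ℝ | ∀ i, (ω i).2 ∈ Icc (0 : ℝ) 1} := by
      intro j
      have : {ω : Fin j → S × ℝ | ∀ i, (ω i).2 ∈ Icc (0 : ℝ) 1}
          = ⋂ i, (fun ω : Fin j → S × ℝ => (ω i).2) ⁻¹' Icc (0 : ℝ) 1 := by
        ext; simp
      rw [this]
      exact MeasurableSet.iInter fun i =>
        (measurable_snd.comp (measurable_pi_apply i)) measurableSet_Icc
    unfold trajLaw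
    rw [Kernel.map_apply _ (measurable_finCons k),
      ae_map_iff (measurable_finCons k).aemeasurable (hset (k + 1))]
    refine Kernel.ae_compProd_of_ae_ae (measurable_finCons k (hset (k + 1))) ?_
    filter_upwards [ae_envLaw_reward_mem M h x.1 (π.act h x)] with z hz
    rw [Kernel.comap_apply]
    filter_upwards [ih (h + 1) (z.1, x.2 + z.2)] with ω hω
    exact Fin.cases (by simpa using hz) (fun j => by simpa using hω j)

/-- The expectation of `W (y + r_h + ⋯ + r_{h+k-1})` under `π`, started at `x = (s, y)`. -/
def expectedUtility (M : RSMDP S A H) (π : MarkovPolicy S A) (W : ℝ → ℝ) (k h : ℕ) (x : S × ℝ) :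
    ℝ :=
  ∫ ω, W (x.2 + ∑ i, (ω i).2) ∂trajLaw M π k h x

variable (M : RSMDP S A H) (π : MarkovPolicy S A) {W : ℝ → ℝ} {m b : ℝ}

theorem measurable_finalReward {α : Type*} [MeasurableSpace α] (k : ℕ) {g : α → ℝ}
    (hg : Measurable g) :
    Measurable fun q : α × (Fin k → S × ℝ) => g q.1 + ∑ i, (q.2 i).2 :=
  (hg.comp measurable_fst).add <| Finset.measurable_sum _ fun i _ =>
    measurable_snd.comp ((measurable_pi_apply i).comp measurable_snd)

theorem measurable_expectedUtility (hW : Measurable W) (k h : ℕ) :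
    Measurable (expectedUtility M π W k h) := by
  have h1 : StronglyMeasurable fun q : (S × ℝ) × (Fin k → S × ℝ) => W (q.1.2 + ∑ i, (q.2 i).2) :=
    (hW.comp (measurable_finalReward k measurable_snd)).stronglyMeasurable
  exact (h1.integral_kernel_prod_right' (κ := trajLaw M π k h)).measurable

theorem expectedUtility_mem (hW : Measurable W) (hb : ∀ x, W x ∈ Icc m b) (k h : ℕ)
    (x : S × ℝ) : expectedUtility M π W k h x ∈ Icc m b := by
  refine integral_mem_Icc ?_ fun _ => hb _
  exact (hW.comp (measurable_finalReward k measurable_snd)).comp (measurable_prodMk_left (x := x))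

theorem expectedUtility_zero (h : ℕ) (x : S × ℝ) : expectedUtility M π W 0 h x = W x.2 := by
  simp [expectedUtility]

/-- The first reward is absorbed into the accumulated reward, and Fubini for the composition-product
separates the first step from the rest. Boundedness of `W` supplies integrability. -/
theorem expectedUtility_succ (hW : Measurable W) (hb : ∀ x, W x ∈ Icc m b) (k h : ℕ)
    (x : S × ℝ) :
    expectedUtility M π W (k + 1) h x
      = ∫ z, expectedUtility M π W k (h + 1) (z.1, x.2 + z.2) ∂envLaw M h x.1 (π.act h x) := by
  have hm : Measurable fun q : (S × ℝ) × (Fin k → S × ℝ) =>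
      W (x.2 + q.1.2 + ∑ i, (q.2 i).2) :=
    hW.comp (measurable_finalReward k (measurable_snd.const_add x.2))
  have hm' : Measurable fun ω : Fin (k + 1) → S × ℝ => W (x.2 + ∑ i, (ω i).2) :=
    (hW.comp (measurable_finalReward (k + 1) measurable_snd)).comp (measurable_prodMk_left (x := x))
  rw [expectedUtility, trajLaw, Kernel.map_apply _ (measurable_finCons k),
    integral_map (measurable_finCons k).aemeasurable hm'.aestronglyMeasurable]
  have he : ∀ q : (S × ℝ) × (Fin k → S × ℝ),
      W (x.2 + ∑ i, ((Fin.cons q.1 q.2 : Fin (k + 1) → S × ℝ) i).2)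
        = W (x.2 + q.1.2 + ∑ i, (q.2 i).2) := by
    intro q
    rw [Fin.sum_univ_succ]
    simp [add_assoc]
  simp only [he]
  rw [integral_compProd (Integrable.of_mem_Icc m b hm.aemeasurable (ae_of_all _ fun _ => hb _)),
    stepKernel_apply]
  rfl

end ValueRecursion

/-! ### Exact dynamic programming and its stability under rounding of rewards -/

section DynamicProgramming

variable {S : Type u} {A : Type v} [Fintype S] [MeasurableSpace S] [DiscreteMeasurableSpace S]
  [Fintype A] [Nonempty A] [MeasurableSpace A] [DiscreteMeasurableSpace A] {H : ℕ}

/-- The exact backup when rewards are transformed by `φ`. -/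
def exactBackup (M : RSMDP S A H) (φ : ℝ → ℝ) (h : ℕ) (V : S → ℝ → ℝ) (s : S) (y : ℝ) (a : A) :
    ℝ :=
  ∫ z, V z.1 (y + φ z.2) ∂envLaw M h s a

/-- Exact value iteration with `k` stages to go when rewards are transformed by `φ`. -/
def exactIter (M : RSMDP S A H) (φ : ℝ → ℝ) (W : ℝ → ℝ) : ℕ → S → ℝ → ℝ
  | 0 => fun _ y => W y
  | k + 1 => fun s y => Finset.univ.sup' Finset.univ_nonempty
      (exactBackup M φ (H - k) (exactIter M φ W k) s y)

variable (M : RSMDP S A H) {φ ψ : ℝ → ℝ} {κ : ℝ≥0} {m b : ℝ} {V : S → ℝ → ℝ} {W : ℝ → ℝ}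

theorem measurable_exactBackup_integrand (hφ : Measurable φ) (hV : IsRegularValue κ m b V)
    (y : ℝ) : Measurable fun z : S × ℝ => V z.1 (y + φ z.2) :=
  hV.measurable.comp (measurable_fst.prodMk ((hφ.comp measurable_snd).const_add y))

theorem integrable_exactBackup_integrand (hφ : Measurable φ) (hV : IsRegularValue κ m b V)
    (h : ℕ) (s : S) (a : A) (y : ℝ) :
    Integrable (fun z : S × ℝ => V z.1 (y + φ z.2)) (envLaw M h s a) :=
  Integrable.of_mem_Icc m b (measurable_exactBackup_integrand hφ hV y).aemeasurable
    (ae_of_all _ fun _ => hV.mem _ _)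

theorem exactBackup_mem (hφ : Measurable φ) (hV : IsRegularValue κ m b V) (h : ℕ) (s : S)
    (y : ℝ) (a : A) : exactBackup M φ h V s y a ∈ Icc m b :=
  integral_mem_Icc (measurable_exactBackup_integrand hφ hV y) fun _ => hV.mem _ _

theorem abs_exactBackup_sub_le (hφ : Measurable φ) (hV : IsRegularValue κ m b V) (h : ℕ) (s : S)
    (y y' : ℝ) (a : A) :
    |exactBackup M φ h V s y a - exactBackup M φ h V s y' a| ≤ κ * |y - y'| := by
  refine abs_integral_sub_integral_le (integrable_exactBackup_integrand M hφ hV h s a y)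
    (integrable_exactBackup_integrand M hφ hV h s a y') (ae_of_all _ fun z => ?_)
  simpa using hV.abs_sub_le z.1 (y + φ z.2) (y' + φ z.2)

/-- Shifting `y` shifts every argument equally, so averaging and maximizing preserve the constant
`κ`, whatever `φ` is. -/
theorem isRegularValue_exactIter (hφ : Measurable φ) (hW : LipschitzWith κ W)
    (hb : ∀ x, W x ∈ Icc m b) (k : ℕ) :
    IsRegularValue κ m b (exactIter M φ W k) := by
  induction k with
  | zero => exact ⟨fun _ => hW, fun _ => hb⟩
  | succ k ih =>
    refine ⟨fun s => LipschitzWith.of_dist_le_mul fun y y' => ?_, fun s y => ?_⟩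
    · rw [Real.dist_eq, Real.dist_eq]
      exact abs_sup'_sub_sup'_le Finset.univ_nonempty fun a _ => abs_exactBackup_sub_le M hφ ih _ s y y' a
    · obtain ⟨a, _, ha⟩ := Finset.exists_mem_eq_sup' Finset.univ_nonempty
        (exactBackup M φ (H - k) (exactIter M φ W k) s y)
      change Finset.sup' _ Finset.univ_nonempty _ ∈ _
      rw [ha]
      exact exactBackup_mem M hφ ih _ _ _ _

/-- Transforming each reward by at most `ε` changes the exact values by at most `κ ε` a stage. -/
theorem abs_exactIter_sub_le (hφ : Measurable φ) (hψ : Measurable ψ) (hW : LipschitzWith κ W)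
    (hb : ∀ x, W x ∈ Icc m b) {ε : ℝ} (hε : ∀ r ∈ Icc (0 : ℝ) 1, |φ r - ψ r| ≤ ε) (k : ℕ) (s : S)
    (y : ℝ) : |exactIter M φ W k s y - exactIter M ψ W k s y| ≤ k * (κ * ε) := by
  induction k generalizing s y with
  | zero => simp [exactIter]
  | succ k ih =>
    have hVφ := isRegularValue_exactIter M hφ hW hb k
    have hVψ := isRegularValue_exactIter M hψ hW hb k
    refine abs_sup'_sub_sup'_le Finset.univ_nonempty fun a _ => ?_
    refine abs_integral_sub_integral_le (integrable_exactBackup_integrand M hφ hVφ _ s a y)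
      (integrable_exactBackup_integrand M hψ hVψ _ s a y) ?_
    filter_upwards [ae_envLaw_reward_mem M (H - k) s a] with z hz
    have h1 := hVφ.abs_sub_le z.1 (y + φ z.2) (y + ψ z.2)
    rw [add_sub_add_left_eq_sub] at h1
    have h2 := h1.trans (mul_le_mul_of_nonneg_left (hε z.2 hz) κ.2)
    have h3 := ih z.1 (y + ψ z.2)
    have h4 := abs_sub_le (exactIter M φ W k z.1 (y + φ z.2))
      (exactIter M φ W k z.1 (y + ψ z.2)) (exactIter M ψ W k z.1 (y + ψ z.2))
    have h5 : (κ : ℝ) * ε = κ.1 * ε := rfl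
    push_cast
    linarith

/-- No policy beats the values computed by dynamic programming. -/
theorem expectedUtility_le_exactIter (π : MarkovPolicy S A) (hW : LipschitzWith κ W)
    (hb : ∀ x, W x ∈ Icc m b) {k : ℕ} (hk : k ≤ H) (x : S × ℝ) :
    expectedUtility M π W k (H + 1 - k) x ≤ exactIter M id W k x.1 x.2 := by
  have hWm : Measurable W := hW.continuous.measurable
  induction k generalizing x with
  | zero => rw [expectedUtility_zero]; rfl
  | succ k ih =>
    have e1 : H + 1 - (k + 1) = H - k := by omega
    have e2 : H - k + 1 = H + 1 - k := by omega
    rw [e1, expectedUtility_succ M π hWm hb, e2]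
    -- The action of the policy is one of the candidates in the maximum.
    refine le_trans ?_ (Finset.le_sup' _ (Finset.mem_univ (π.act (H - k) x)))
    have hV := isRegularValue_exactIter M measurable_id hW hb k
    refine integral_mono ?_ (integrable_exactBackup_integrand M measurable_id hV _ _ _ _) ?_
    · refine Integrable.of_mem_Icc m b (Measurable.aemeasurable ?_)
        (ae_of_all _ fun z => expectedUtility_mem M π hWm hb _ _ _)
      exact (measurable_expectedUtility M π hWm _ _).comp
        (measurable_fst.prodMk (measurable_snd.const_add x.2))
    · exact fun z => ih (by omega) _

end DynamicProgramming

/-! ### Extension of the utility to the real line -/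

section ClampedUtility

variable {S : Type u} {A : Type v} [Fintype S] [MeasurableSpace S] [DiscreteMeasurableSpace S]
  [Fintype A] [MeasurableSpace A] [DiscreteMeasurableSpace A] {H : ℕ}

/-- The utility function extended to the real line by constants. -/
def clampedUtility (M : RSMDP S A H) : ℝ → ℝ :=
  fun x => M.U (projIcc (0 : ℝ) H (Nat.cast_nonneg H) x)

variable (M : RSMDP S A H) {κ : ℝ≥0}

theorem clampedUtility_eq {x : ℝ} (hx : x ∈ Icc (0 : ℝ) H) : clampedUtility M x = M.U x := by
  simp [clampedUtility, projIcc_of_mem _ hx]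

theorem lipschitzWith_clampedUtility (hU : LipschitzOnWith κ M.U (Icc (0 : ℝ) H)) :
    LipschitzWith κ (clampedUtility M) := by
  have h := hU.to_restrict.comp (LipschitzWith.projIcc (Nat.cast_nonneg (α := ℝ) H))
  rwa [mul_one] at h

theorem clampedUtility_mem (hU : LipschitzOnWith κ M.U (Icc (0 : ℝ) H)) (x : ℝ) :
    clampedUtility M x ∈ Icc (M.U 0) (M.U 0 + κ * H) := by
  have hz := (projIcc (0 : ℝ) H (Nat.cast_nonneg H) x).2
  change M.U (projIcc (0 : ℝ) H (Nat.cast_nonneg H) x) ∈ _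
  set z : ℝ := (projIcc (0 : ℝ) H (Nat.cast_nonneg H) x : ℝ)
  have h0 : (0 : ℝ) ∈ Icc (0 : ℝ) H := ⟨le_rfl, Nat.cast_nonneg H⟩
  refine ⟨M.strictMono_U.monotoneOn h0 hz hz.1, ?_⟩
  have h := hU.dist_le_mul z hz 0 h0
  rw [Real.dist_eq, Real.dist_eq, sub_zero, abs_of_nonneg hz.1] at h
  have h2 : (κ : ℝ) * z ≤ κ * H := mul_le_mul_of_nonneg_left hz.2 κ.2
  linarith [le_abs_self (M.U z - M.U 0)]

/-- Almost surely the rewards lie in `[0, 1]`, so the final total stays in `[0, H]`, where the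
extension changes nothing. -/
theorem value_eq_expectedUtility (π : MarkovPolicy S A) {h : ℕ} (hh : h ∈ Icc 1 H) (s : S)
    {y : ℝ} (hy : y ∈ Icc (0 : ℝ) (h - 1)) :
    value M π h s y = expectedUtility M π (clampedUtility M) (H + 1 - h) h (s, y) := by
  refine integral_congr_ae ?_
  filter_upwards [ae_trajLaw_reward_mem M π (H + 1 - h) h (s, y)] with ω hω
  refine (clampedUtility_eq M ⟨add_nonneg hy.1 (Finset.sum_nonneg fun i _ => (hω i).1), ?_⟩).symm
  have h1 : ∑ i, (ω i).2 ≤ ((H + 1 - h : ℕ) : ℝ) := by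
    simpa using Finset.sum_le_sum fun i (_ : i ∈ Finset.univ) => (hω i).2
  rw [Nat.cast_sub (by have := hh.2; omega)] at h1
  push_cast at h1
  have := hy.2
  linarith

end ClampedUtility

/-! ### Geometry of the nets -/

section GridLemmas

variable {ε : ℝ}

/-- The nearest point is no farther than the multiple of `ε` just below `y`. The bound cannot be `ε
/ 2` in general, since `c` may lie almost `ε` beyond the last net point. -/
theorem abs_gridProj_sub_le (hε : 0 < ε) {c y : ℝ} (hy : y ∈ Icc 0 c) :
    |gridProj ε c y - y| ≤ ε := by
  have hm : ((⌊y / ε⌋₊ : ℕ) : ℝ) * ε ∈ grid ε c := by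
    refine Finset.mem_image.2 ⟨_, Finset.mem_range.2 (Nat.lt_succ_of_le ?_), rfl⟩
    exact Nat.floor_le_floor (div_le_div_of_nonneg_right hy.2 hε.le)
  rw [abs_sub_comm]
  refine (gridProj_spec hε c y hm).1.trans ?_
  have h1 := Nat.floor_le (div_nonneg hy.1 hε.le)
  have h2 := (Nat.lt_floor_add_one (y / ε)).le
  rw [le_div_iff₀ hε] at h1
  rw [div_le_iff₀ hε] at h2
  exact abs_le.2 ⟨by linarith, by linarith⟩

theorem mem_Icc_of_mem_grid (hε : 0 < ε) {c z : ℝ} (hc : 0 ≤ c) (hz : z ∈ grid ε c) :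
    z ∈ Icc 0 c := by
  obtain ⟨j, hj, rfl⟩ := Finset.mem_image.1 hz
  have h1 : (j : ℝ) ≤ c / ε := (Nat.le_floor_iff (div_nonneg hc hε.le)).1
    (Nat.lt_succ_iff.1 (Finset.mem_range.1 hj))
  exact ⟨by positivity, (le_div_iff₀ hε).1 h1⟩

theorem add_mem_grid (hε : 0 < ε) {c d y r : ℝ} (hc : 0 ≤ c) (hd : 0 ≤ d) (hy : y ∈ grid ε c)
    (hr : r ∈ grid ε d) : y + r ∈ grid ε (c + d) := by
  obtain ⟨i, hi, rfl⟩ := Finset.mem_image.1 hy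
  obtain ⟨j, hj, rfl⟩ := Finset.mem_image.1 hr
  have h1 : (i : ℝ) ≤ c / ε := (Nat.le_floor_iff (div_nonneg hc hε.le)).1
    (Nat.lt_succ_iff.1 (Finset.mem_range.1 hi))
  have h2 : (j : ℝ) ≤ d / ε := (Nat.le_floor_iff (div_nonneg hd hε.le)).1
    (Nat.lt_succ_iff.1 (Finset.mem_range.1 hj))
  refine Finset.mem_image.2 ⟨i + j, Finset.mem_range.2 (Nat.lt_succ_of_le (Nat.le_floor ?_)), ?_⟩
  · rw [add_div]
    push_cast
    linarith
  · push_cast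
    ring

theorem card_grid_le (hε : 0 < ε) (hε1 : ε ≤ 1) {c : ℝ} (hc : 0 ≤ c) :
    ((grid ε c).card : ℝ) ≤ (c + 1) / ε := by
  have h1 : (grid ε c).card ≤ ⌊c / ε⌋₊ + 1 :=
    Finset.card_image_le.trans_eq (Finset.card_range _)
  have h2 : ((grid ε c).card : ℝ) ≤ ⌊c / ε⌋₊ + 1 := by exact_mod_cast h1
  have h3 := Nat.floor_le (div_nonneg hc hε.le)
  have h4 : 1 ≤ 1 / ε := (le_div_iff₀ hε).2 (by linarith)
  rw [add_div]
  linarith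

end GridLemmas

/-! ### The empirical backup as an average over pairs of samples -/

section EmpiricalBackup

variable {S : Type u} {A : Type v} [Fintype S] {n : ℕ} {ε : ℝ} (D : SampleTable S A n)

/-- Multiplying the two empirical frequencies pairs the state of each sample with the reward of
every sample. This is the form the concentration inequality takes. -/
theorem backup_eq_sum (h : ℕ) (V : S → ℝ → ℝ) (s : S) (y : ℝ) (a : A) :
    backup ε D h V s y a
      = (∑ i, ∑ j, V (D s a h i).1 (y + gridProj ε 1 (D s a h j).2)) / (n : ℝ) ^ 2 := by
  classical
  have key : ∀ i j : Fin n, ∑ s' : S, ∑ r ∈ grid ε 1,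
      ({s'} : Set S).indicator (fun _ => (1 : ℝ)) (D s a h i).1 *
        ({r} : Set ℝ).indicator (fun _ => (1 : ℝ)) (gridProj ε 1 (D s a h j).2) * V s' (y + r)
      = V (D s a h i).1 (y + gridProj ε 1 (D s a h j).2) := by
    intro i j
    rw [Finset.sum_eq_single (D s a h i).1, Finset.sum_eq_single (gridProj ε 1 (D s a h j).2)]
    · simp
    · intro r _ hr
      simp [Set.indicator, hr.symm]
    · exact fun hn => absurd (gridProj_mem _ _ _) hn
    · intro s' _ hs'
      simp [Set.indicator, hs'.symm]
    · exact fun hn => absurd (Finset.mem_univ _) hn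
  simp only [← key]
  rw [backup]
  have hterm : ∀ (s' : S) (r : ℝ), empP D h s a s' * empR ε D h s a r * V s' (y + r)
      = (∑ i, ∑ j, ({s'} : Set S).indicator (fun _ => (1 : ℝ)) (D s a h i).1 *
        ({r} : Set ℝ).indicator (fun _ => (1 : ℝ)) (gridProj ε 1 (D s a h j).2) * V s' (y + r))
          / (n : ℝ) ^ 2 := by
    intro s' r
    simp only [← Finset.sum_mul, ← Finset.mul_sum]
    rw [empP, empR]
    ring
  simp only [hterm, ← Finset.sum_div]
  congr 1
  have swap : ∀ s' : S, ∑ r ∈ grid ε 1, ∑ i, ∑ j,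
      ({s'} : Set S).indicator (fun _ => (1 : ℝ)) (D s a h i).1 *
        ({r} : Set ℝ).indicator (fun _ => (1 : ℝ)) (gridProj ε 1 (D s a h j).2) * V s' (y + r)
      = ∑ i, ∑ j, ∑ r ∈ grid ε 1, ({s'} : Set S).indicator (fun _ => (1 : ℝ)) (D s a h i).1 *
        ({r} : Set ℝ).indicator (fun _ => (1 : ℝ)) (gridProj ε 1 (D s a h j).2) * V s' (y + r) := by
    intro s'
    rw [Finset.sum_comm]
    exact Finset.sum_congr rfl fun i _ => Finset.sum_comm
  simp only [swap]
  rw [Finset.sum_comm]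
  exact Finset.sum_congr rfl fun i _ => Finset.sum_comm

theorem abs_backup_sub_le (hn : 1 ≤ n) {h : ℕ} {V V' : S → ℝ → ℝ} {s : S} {y : ℝ} {a : A} {e : ℝ}
    (hV : ∀ s', ∀ r ∈ grid ε 1, |V s' (y + r) - V' s' (y + r)| ≤ e) :
    |backup ε D h V s y a - backup ε D h V' s y a| ≤ e := by
  have hn0 : (0 : ℝ) < (n : ℝ) ^ 2 := by positivity
  rw [backup_eq_sum, backup_eq_sum, ← sub_div, abs_div, abs_of_pos hn0, div_le_iff₀ hn0,
    ← Finset.sum_sub_distrib]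
  simp only [← Finset.sum_sub_distrib]
  refine (Finset.abs_sum_le_sum_abs _ _).trans ((Finset.sum_le_sum fun i _ =>
    (Finset.abs_sum_le_sum_abs _ _).trans (Finset.sum_le_sum fun j _ =>
      hV _ _ (gridProj_mem ε 1 _))).trans_eq ?_)
  simp
  ring

end EmpiricalBackup

/-! ### Propagation of estimation and rounding errors -/

section ErrorPropagation

variable {S : Type u} {A : Type v} [Fintype S] [MeasurableSpace S] [DiscreteMeasurableSpace S]
  [Fintype A] [Nonempty A] [MeasurableSpace A] [DiscreteMeasurableSpace A] {H n : ℕ}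
  {M : RSMDP S A H} {κ : ℝ≥0} {ε δ : ℝ} {D : SampleTable S A n}

/-- The exact value iteration for the model with projected rewards. -/
def projectedIter (M : RSMDP S A H) (ε : ℝ) : ℕ → S → ℝ → ℝ :=
  exactIter M (gridProj ε 1) (clampedUtility M)

/-- The samples `D` estimate every backup of the projected model within `δ` on the nets. -/
def BackupsWithin (M : RSMDP S A H) (ε δ : ℝ) (D : SampleTable S A n) : Prop :=
  ∀ h ∈ Icc 1 H, ∀ (s : S) (a : A), ∀ y ∈ grid ε ((h : ℝ) - 1),
    |backup ε D h (projectedIter M ε (H - h)) s y a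
      - exactBackup M (gridProj ε 1) h (projectedIter M ε (H - h)) s y a| ≤ δ

theorem isRegularValue_projectedIter (hU : LipschitzOnWith κ M.U (Icc (0 : ℝ) H)) (k : ℕ) :
    IsRegularValue κ (M.U 0) (M.U 0 + κ * H) (projectedIter M ε k) :=
  isRegularValue_exactIter M (measurable_gridProj ε 1) (lipschitzWith_clampedUtility M hU)
    (clampedUtility_mem M hU) k

theorem stage_sub_one_nonneg {h : ℕ} (hh : 1 ≤ h) : (0 : ℝ) ≤ (h : ℝ) - 1 := by
  have : (1 : ℝ) ≤ h := by exact_mod_cast hh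
  linarith

/-- Each stage adds one estimation error `δ`, and the empirical backup does not expand the error
inherited from the next stage. Only net points are compared, because the accuracy assumption covers
no others. -/
theorem abs_viguIter_sub_le (hε : 0 < ε) (hn : 1 ≤ n) (hD : BackupsWithin M ε δ D) (k : ℕ) :
    ∀ h, 1 ≤ h → h + k = H + 1 → ∀ (s : S), ∀ y ∈ grid ε ((h : ℝ) - 1),
      |viguIter M.U H ε D k s y - projectedIter M ε k s y| ≤ k * δ := by
  induction k with
  | zero =>
    intro h hh hk s y hy
    have hy' := mem_Icc_of_mem_grid hε (stage_sub_one_nonneg hh) hy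
    -- The terminal stage is `H + 1`; its net lies in `[0, H]`, where the clamped utility agrees
    -- with `U`.
    have e : (h : ℝ) - 1 = H := by
      have : h = H + 1 := hk
      rw [this]
      push_cast
      ring
    rw [e] at hy'
    simp [viguIter, projectedIter, exactIter, clampedUtility_eq M hy']
  | succ k ih =>
    intro h hh hk s y hy
    have e1 : H - k = h := by omega
    have e2 : H - h = k := by omega
    refine abs_sup'_sub_sup'_le Finset.univ_nonempty fun a _ => ?_
    change |backup ε D (H - k) (viguIter M.U H ε D k) s y a
      - exactBackup M (gridProj ε 1) (H - k) (projectedIter M ε k) s y a| ≤ _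
    rw [e1]
    have h1 := hD h ⟨hh, by omega⟩ s a y hy
    rw [e2] at h1
    have h2 : |backup ε D h (viguIter M.U H ε D k) s y a
        - backup ε D h (projectedIter M ε k) s y a| ≤ k * δ := by
      refine abs_backup_sub_le D hn fun s' r hr => ih (h + 1) (by omega) (by omega) s' _ ?_
      have h3 := add_mem_grid hε (stage_sub_one_nonneg hh) zero_le_one hy hr
      convert h3 using 2
      push_cast
      ring
    have h4 := abs_sub_le (backup ε D h (viguIter M.U H ε D k) s y a)
      (backup ε D h (projectedIter M ε k) s y a)
      (exactBackup M (gridProj ε 1) h (projectedIter M ε k) s y a)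
    push_cast
    linarith

theorem viguIter_succ_eq_backup {πhat : GridPolicy S A ε} (hπ : IsVIGUPolicy M.U H D πhat) {h k : ℕ}
    (hh : 1 ≤ h) (hk : h + (k + 1) = H + 1) (s : S) (y : {y : ℝ // y ∈ grid ε ((h : ℝ) - 1)}) :
    viguIter M.U H ε D (k + 1) s y = backup ε D h (viguIter M.U H ε D k) s y (πhat h s y) := by
  have e1 : H - k = h := by omega
  have e2 : H + 1 - (h + 1) = k := by omega
  have h1 := hπ h ⟨hh, by omega⟩ s y
  simp only [viguQ, viguV, e2] at h1
  rw [viguIter, e1]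
  exact le_antisymm (Finset.sup'_le _ _ fun a _ => h1 a) (Finset.le_sup' _ (Finset.mem_univ _))

/-- The value of the interpolated greedy policy stays close to the values of the projected
model. -/
theorem abs_expectedUtility_interpolate_sub_le (hU : LipschitzOnWith κ M.U (Icc (0 : ℝ) H))
    (hε : 0 < ε) (hδ : 0 ≤ δ) (hn : 1 ≤ n) (hD : BackupsWithin M ε δ D)
    {πhat : GridPolicy S A ε} (hπ : IsVIGUPolicy M.U H D πhat) (k : ℕ) :
    ∀ h, 1 ≤ h → h + k = H + 1 → ∀ (s : S), ∀ y ∈ Icc (0 : ℝ) ((h : ℝ) - 1),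
      |expectedUtility M (interpolate πhat) (clampedUtility M) k h (s, y)
          - projectedIter M ε k s (gridProj ε ((h : ℝ) - 1) y)|
        ≤ κ * ε + k * (3 * κ * ε + 2 * H * δ) := by
  have hWL := lipschitzWith_clampedUtility M hU
  have hWm : Measurable (clampedUtility M) := hWL.continuous.measurable
  have hWb := clampedUtility_mem M hU
  have hκ : (0 : ℝ) ≤ κ := κ.2
  induction k with
  | zero =>
    intro h hh hk s y hy
    rw [expectedUtility_zero]
    have h1 := (isRegularValue_projectedIter (M := M) (ε := ε) hU 0).abs_sub_le s y
      (gridProj ε ((h : ℝ) - 1) y)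
    have h2 := abs_gridProj_sub_le hε hy
    rw [abs_sub_comm] at h2
    have h3 := mul_le_mul_of_nonneg_left h2 hκ
    have h4 : projectedIter M ε 0 s y = clampedUtility M y := rfl
    rw [h4] at h1
    push_cast
    linarith
  | succ k ih =>
    intro h hh hk s y hy
    have e2 : H - h = k := by omega
    have hV := isRegularValue_projectedIter (M := M) (ε := ε) hU k
    set g := gridProj ε ((h : ℝ) - 1) y with hg
    have hgm : g ∈ grid ε ((h : ℝ) - 1) := gridProj_mem _ _ _
    set a := πhat h s ⟨g, hgm⟩ with ha
    have hact : (interpolate πhat).act h (s, y) = a := rfl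
    rw [expectedUtility_succ M _ hWm hWb, hact]
    -- Rounding the new total and adding the rounded old total to the rounded reward can give
    -- different net points. Three rounding errors separate them, whence `κ * (3 * ε)`.
    have h1 : |∫ z, expectedUtility M (interpolate πhat) (clampedUtility M) k (h + 1)
          (z.1, y + z.2) ∂envLaw M h s a
        - exactBackup M (gridProj ε 1) h (projectedIter M ε k) s g a|
        ≤ κ * ε + k * (3 * κ * ε + 2 * H * δ) + κ * (3 * ε) := by
      refine abs_integral_sub_integral_le ?_
        (integrable_exactBackup_integrand M (measurable_gridProj ε 1) hV _ _ _ _) ?_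
      · refine Integrable.of_mem_Icc _ _ (Measurable.aemeasurable ?_)
          (ae_of_all _ fun z => expectedUtility_mem M _ hWm hWb _ _ _)
        exact (measurable_expectedUtility M _ hWm _ _).comp
          (measurable_fst.prodMk (measurable_snd.const_add y))
      · filter_upwards [ae_envLaw_reward_mem M h s a] with z hz
        have hc : (((h + 1 : ℕ) : ℝ) - 1) = (h : ℝ) := by push_cast; ring
        have hyz : y + z.2 ∈ Icc (0 : ℝ) (((h + 1 : ℕ) : ℝ) - 1) := by
          rw [hc]
          exact ⟨add_nonneg hy.1 hz.1, by linarith [hy.2, hz.2]⟩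
        have t1 := ih (h + 1) (by omega) (by omega) z.1 (y + z.2) hyz
        have t2 := hV.abs_sub_le z.1 (gridProj ε (((h + 1 : ℕ) : ℝ) - 1) (y + z.2))
          (g + gridProj ε 1 z.2)
        have p1 := abs_le.1 (abs_gridProj_sub_le hε hyz)
        have p2 := abs_le.1 (abs_gridProj_sub_le hε hy)
        have p3 := abs_le.1 (abs_gridProj_sub_le hε hz)
        have t3 : |gridProj ε (((h + 1 : ℕ) : ℝ) - 1) (y + z.2) - (g + gridProj ε 1 z.2)|
            ≤ 3 * ε :=
          abs_le.2 ⟨by linarith [p1.1, p2.2, p3.2], by linarith [p1.2, p2.1, p3.1]⟩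
        have t4 := mul_le_mul_of_nonneg_left t3 hκ
        exact (abs_sub_le _ _ _).trans (add_le_add t1 (t2.trans t4))
    have h2 := hD h ⟨hh, by omega⟩ s a g hgm
    rw [e2] at h2
    have h3 : |backup ε D h (viguIter M.U H ε D k) s g a
        - backup ε D h (projectedIter M ε k) s g a| ≤ k * δ := by
      refine abs_backup_sub_le D hn fun s' r hr =>
        abs_viguIter_sub_le hε hn hD k (h + 1) (by omega) (by omega) s' _ ?_
      have h3 := add_mem_grid hε (stage_sub_one_nonneg hh) zero_le_one hgm hr
      convert h3 using 2
      push_cast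
      ring
    have h4 := abs_viguIter_sub_le hε hn hD (k + 1) h hh hk s g hgm
    have h5 := viguIter_succ_eq_backup hπ hh hk s ⟨g, hgm⟩
    simp only at h5
    rw [h5, ← ha] at h4
    -- The estimation errors are `δ` from `h2`, `k * δ` from `h3` and `(k + 1) * δ` from `h4`: in
    -- all `2 * (k + 1) * δ ≤ 2 * H * δ`.
    have hkH : (k : ℝ) + 1 ≤ H := by exact_mod_cast (show k + 1 ≤ H by omega)
    have hkδ := mul_le_mul_of_nonneg_right hkH hδ
    rw [abs_le] at h1 h2 h3 h4 ⊢
    push_cast at h4 ⊢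
    constructor <;> linarith [h1.1, h1.2, h2.1, h2.2, h3.1, h3.2, h4.1, h4.2]

theorem abs_value_sub_le (hU : LipschitzOnWith κ M.U (Icc (0 : ℝ) H)) {πstar : MarkovPolicy S A}
    (hopt : IsOptimalPolicy M πstar) (hε : 0 < ε) (hδ : 0 ≤ δ) (hn : 1 ≤ n)
    (hD : BackupsWithin M ε δ D) {πhat : GridPolicy S A ε} (hπ : IsVIGUPolicy M.U H D πhat)
    {h : ℕ} (hh : h ∈ Icc 1 H) (s : S) {y : ℝ} (hy : y ∈ Icc (0 : ℝ) (h - 1)) :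
    |value M πstar h s y - value M (interpolate πhat) h s y|
      ≤ 6 * H * κ * ε + 2 * H ^ 2 * δ := by
  obtain ⟨hh1, hh2⟩ := hh
  have hWL := lipschitzWith_clampedUtility M hU
  have hWb := clampedUtility_mem M hU
  -- Optimality is used only to fix the sign; the upper bound on the optimal value holds for every
  -- policy.
  rw [abs_of_nonneg (sub_nonneg.2 (hopt h ⟨hh1, hh2⟩ s y hy _))]
  rw [value_eq_expectedUtility M _ ⟨hh1, hh2⟩ s hy, value_eq_expectedUtility M _ ⟨hh1, hh2⟩ s hy]
  obtain ⟨k, hk⟩ : ∃ k, h + k = H + 1 := ⟨H + 1 - h, by omega⟩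
  have e1 : H + 1 - h = k := by omega
  have e2 : h = H + 1 - k := by omega
  have hkH : k ≤ H := by omega
  rw [e1]
  have h1 := expectedUtility_le_exactIter M πstar hWL hWb hkH (s, y)
  rw [← e2] at h1
  have h2 := (abs_le.1 (abs_exactIter_sub_le M (measurable_gridProj ε 1) measurable_id hWL hWb
    (fun r hr => abs_gridProj_sub_le hε hr) k s y)).1
  have h3 := (isRegularValue_projectedIter (M := M) (ε := ε) hU k).abs_sub_le s y
    (gridProj ε ((h : ℝ) - 1) y)
  have hκ : (0 : ℝ) ≤ κ := κ.2
  have h4 := abs_gridProj_sub_le hε hy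
  rw [abs_sub_comm] at h4
  have h5 := (abs_le.1 (h3.trans (mul_le_mul_of_nonneg_left h4 hκ))).2
  have h6 := (abs_le.1 (abs_expectedUtility_interpolate_sub_le hU hε hδ hn hD hπ k h hh1 hk s y
    hy)).1
  have hkH' : (k : ℝ) ≤ H := by exact_mod_cast hkH
  have hH1 : (1 : ℝ) ≤ H := by exact_mod_cast hh1.trans hh2
  have hκε : 0 ≤ (κ : ℝ) * ε := by positivity
  have h7 := mul_le_mul_of_nonneg_right hkH' hκε
  have h8 := mul_le_mul_of_nonneg_right hkH' (show 0 ≤ 3 * (κ : ℝ) * ε + 2 * H * δ by positivity)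
  have h9 := mul_le_mul_of_nonneg_right hH1 hκε
  have h10 : projectedIter M ε k s y = exactIter M (gridProj ε 1) (clampedUtility M) k s y := rfl
  simp only at h1
  linarith

/-- Any two policies differ in value by at most `H κ`. -/
theorem abs_value_sub_le_of_lipschitz (hU : LipschitzOnWith κ M.U (Icc (0 : ℝ) H))
    (π π' : MarkovPolicy S A) {h : ℕ} (hh : h ∈ Icc 1 H) (s : S) {y : ℝ}
    (hy : y ∈ Icc (0 : ℝ) (h - 1)) : |value M π h s y - value M π' h s y| ≤ H * κ := by
  have hWm : Measurable (clampedUtility M) :=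
    (lipschitzWith_clampedUtility M hU).continuous.measurable
  rw [value_eq_expectedUtility M _ hh s hy, value_eq_expectedUtility M _ hh s hy]
  have h1 := expectedUtility_mem M π hWm (clampedUtility_mem M hU) (H + 1 - h) h (s, y)
  have h2 := expectedUtility_mem M π' hWm (clampedUtility_mem M hU) (H + 1 - h) h (s, y)
  exact abs_le.2 ⟨by linarith [h1.1, h2.2], by linarith [h1.2, h2.1]⟩

end ErrorPropagation

/-! ### Probability that all backups are accurate -/

section GoodEvent

variable {S : Type u} {A : Type v} [Fintype S] [MeasurableSpace S] [DiscreteMeasurableSpace S]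
  [Fintype A] [Nonempty A] [MeasurableSpace A] [DiscreteMeasurableSpace A] {H n : ℕ}
  {M : RSMDP S A H} {κ : ℝ≥0} {ε δ : ℝ} {Ω : Type w} [MeasurableSpace Ω] {μ : Measure Ω}
  {X : S → A → ℕ → Fin n → Ω → S × ℝ}

/-- The indices of the backups estimated by the algorithm. -/
def backupIndices (S : Type u) (A : Type v) [Fintype S] [Fintype A] (H : ℕ) (ε : ℝ) :
    Finset (Σ _ : ℕ, S × A × ℝ) :=
  (Finset.Icc 1 H).sigma fun h => Finset.univ ×ˢ Finset.univ ×ˢ grid ε ((h : ℝ) - 1)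

/-- The estimation error of one backup of the projected model. -/
def backupError (M : RSMDP S A H) (ε : ℝ) (D : SampleTable S A n) (j : Σ _ : ℕ, S × A × ℝ) : ℝ :=
  backup ε D j.1 (projectedIter M ε (H - j.1)) j.2.1 j.2.2.2 j.2.2.1
    - exactBackup M (gridProj ε 1) j.1 (projectedIter M ε (H - j.1)) j.2.1 j.2.2.2 j.2.2.1

theorem backupsWithin_iff {D : SampleTable S A n} :
    BackupsWithin M ε δ D ↔ ∀ j ∈ backupIndices S A H ε, |backupError M ε D j| ≤ δ := by
  constructor
  · rintro hD ⟨h, s, a, y⟩ hj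
    simp only [backupIndices, Finset.mem_sigma, Finset.mem_Icc, Finset.mem_product,
      Finset.mem_univ, true_and] at hj
    exact hD h hj.1 s a y hj.2
  · intro hD h hh s a y hy
    refine hD ⟨h, s, a, y⟩ ?_
    simp only [backupIndices, Finset.mem_sigma, Finset.mem_Icc, Finset.mem_product,
      Finset.mem_univ, true_and]
    exact ⟨hh, hy⟩

/-- The condition `ε ≤ 1` absorbs the extra net point at zero: the net of stage `h` has at most `h /
ε ≤ H / ε` points. -/
theorem card_backupIndices_le (hε : 0 < ε) (hε1 : ε ≤ 1) :
    ((backupIndices S A H ε).card : ℝ)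
      ≤ (H : ℝ) ^ 2 * Fintype.card S * Fintype.card A / ε := by
  have h1 : ∀ h ∈ Finset.Icc 1 H, (((Finset.univ : Finset S) ×ˢ (Finset.univ : Finset A) ×ˢ
      grid ε ((h : ℝ) - 1)).card : ℝ) ≤ Fintype.card S * (Fintype.card A * (H / ε)) := by
    intro h hh
    rw [Finset.mem_Icc] at hh
    have h2 := card_grid_le hε hε1 (stage_sub_one_nonneg hh.1)
    rw [sub_add_cancel] at h2
    have h3 : (h : ℝ) / ε ≤ H / ε :=
      div_le_div_of_nonneg_right (by exact_mod_cast hh.2) hε.le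
    rw [Finset.card_product, Finset.card_product, Finset.card_univ, Finset.card_univ]
    push_cast
    gcongr
    exact h2.trans h3
  rw [backupIndices, Finset.card_sigma]
  push_cast
  refine (Finset.sum_le_sum h1).trans_eq ?_
  simp
  ring

theorem measurable_backupError (hU : LipschitzOnWith κ M.U (Icc (0 : ℝ) H))
    (hX : IsSimulated M μ X) {j : Σ _ : ℕ, S × A × ℝ} (hj : j ∈ backupIndices S A H ε) :
    Measurable fun ω => backupError M ε (fun s a h i => X s a h i ω) j := by
  have hh : j.1 ∈ Icc 1 H := Finset.mem_Icc.1 (Finset.mem_sigma.1 hj).1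
  have hf := measurable_exactBackup_integrand (measurable_gridProj ε 1)
    (isRegularValue_projectedIter (M := M) (ε := ε) hU (H - j.1)) j.2.2.2
  simp only [backupError, backup_eq_sum]
  refine Measurable.sub_const (Measurable.div_const ?_ _) _
  refine Finset.measurable_sum _ fun i _ => Finset.measurable_sum _ fun i' _ => ?_
  exact hf.comp ((measurable_fst.comp (hX.measurable _ _ _ hh i)).prodMk
    (measurable_snd.comp (hX.measurable _ _ _ hh i')))

theorem measure_backupError_ge_le [IsProbabilityMeasure μ]
    (hU : LipschitzOnWith κ M.U (Icc (0 : ℝ) H)) (hn : 1 ≤ n) (hX : IsSimulated M μ X)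
    (hδ : 0 ≤ δ) {j : Σ _ : ℕ, S × A × ℝ} (hj : j ∈ backupIndices S A H ε) :
    μ.real {ω | δ ≤ |backupError M ε (fun s a h i => X s a h i ω) j|}
      ≤ 2 * Real.exp (-(2 * n * δ ^ 2 / (κ * H) ^ 2)) := by
  have hh : j.1 ∈ Icc 1 H := Finset.mem_Icc.1 (Finset.mem_sigma.1 hj).1
  have hV := isRegularValue_projectedIter (M := M) (ε := ε) hU (H - j.1)
  have hf := measurable_exactBackup_integrand (measurable_gridProj ε 1) hV j.2.2.2
  have := M.isProb_P j.1 j.2.1 j.2.2.1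
  have := M.isProb_R j.1 j.2.1 j.2.2.1
  -- Independence of the whole table is restricted to the `n` samples at one `(s, a, h)`.
  have hinj : Function.Injective
      (fun i : Fin n => ((j.2.1, j.2.2.1, ⟨j.1, hh⟩, i) : S × A × (Icc 1 H : Set ℕ) × Fin n)) :=
    fun i i' h => by simpa using h
  have hind := hX.indep.precomp hinj
  have h := measure_product_empirical_ge_le hn (fun i => hX.measurable j.2.1 j.2.2.1 j.1 hh i)
    (fun i => hX.law j.2.1 j.2.2.1 j.1 hh i) hind hf
    (fun z => hV.mem z.1 (j.2.2.2 + gridProj ε 1 z.2)) hδ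
  rw [add_sub_cancel_left] at h
  simp only [backupError, backup_eq_sum]
  exact h

theorem measurableSet_backupsWithin (hU : LipschitzOnWith κ M.U (Icc (0 : ℝ) H))
    (hX : IsSimulated M μ X) :
    MeasurableSet {ω | BackupsWithin M ε δ (fun s a h i => X s a h i ω)} := by
  have he : {ω | BackupsWithin M ε δ (fun s a h i => X s a h i ω)}
      = ⋂ j ∈ backupIndices S A H ε,
        (fun ω => |backupError M ε (fun s a h i => X s a h i ω) j|) ⁻¹' Iic δ := by
    ext ω
    simp only [mem_ofPred_eq, backupsWithin_iff, mem_iInter, mem_preimage, mem_Iic]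
  rw [he]
  exact Finset.measurableSet_biInter _ fun j hj =>
    (continuous_abs.measurable.comp (measurable_backupError hU hX hj)) measurableSet_Iic

theorem measure_compl_backupsWithin_le [IsProbabilityMeasure μ]
    (hU : LipschitzOnWith κ M.U (Icc (0 : ℝ) H)) (hn : 1 ≤ n) (hX : IsSimulated M μ X)
    (hδ : 0 ≤ δ) (hε : 0 < ε) (hε1 : ε ≤ 1) :
    μ.real {ω | BackupsWithin M ε δ (fun s a h i => X s a h i ω)}ᶜ
      ≤ (H : ℝ) ^ 2 * Fintype.card S * Fintype.card A / ε
        * (2 * Real.exp (-(2 * n * δ ^ 2 / (κ * H) ^ 2))) := by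
  have hsub : {ω | BackupsWithin M ε δ (fun s a h i => X s a h i ω)}ᶜ
      ⊆ ⋃ j ∈ backupIndices S A H ε,
        {ω | δ ≤ |backupError M ε (fun s a h i => X s a h i ω) j|} := by
    intro ω hω
    simp only [mem_compl_iff, mem_ofPred_eq, backupsWithin_iff, not_forall, not_le] at hω
    obtain ⟨j, hj, hlt⟩ := hω
    exact mem_biUnion hj hlt.le
  refine (measureReal_mono hsub (measure_ne_top _ _)).trans ((measureReal_biUnion_finset_le _ _).trans ?_)
  refine (Finset.sum_le_sum fun j hj => measure_backupError_ge_le hU hn hX hδ hj).trans ?_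
  rw [Finset.sum_const, nsmul_eq_mul]
  exact mul_le_mul_of_nonneg_right (card_backupIndices_le hε hε1) (by positivity)

/-- All backups are estimated within `H κ √(ι / n)` with probability at least `1 - p`. -/
theorem measure_backupsWithin_ge [IsProbabilityMeasure μ] [Nonempty S]
    (hU : LipschitzOnWith κ M.U (Icc (0 : ℝ) H)) (hn : 1 ≤ n) (hX : IsSimulated M μ X)
    (hε : 0 < ε) (hε1 : ε ≤ 1) (hκ : κ ≠ 0) (hH : 1 ≤ H) {p : ℝ} (hp : 0 < p) (hp1 : p < 1) :
    ENNReal.ofReal (1 - p) ≤ μ {ω | BackupsWithin M ε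
      (κ * H * √(Real.log (4 * (H : ℝ) ^ 2 * Fintype.card S * Fintype.card A / (p * ε)) / n))
      (fun s a h i => X s a h i ω)} := by
  set N : ℝ := (H : ℝ) ^ 2 * Fintype.card S * Fintype.card A with hN
  have hN4 : 4 * (H : ℝ) ^ 2 * Fintype.card S * Fintype.card A = 4 * N := by rw [hN]; ring
  rw [hN4]
  have hS : (1 : ℝ) ≤ Fintype.card S := by exact_mod_cast Fintype.card_pos
  have hA : (1 : ℝ) ≤ Fintype.card A := by exact_mod_cast Fintype.card_pos
  have hHr : (1 : ℝ) ≤ H := by exact_mod_cast hH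
  have hN1 : 1 ≤ N := one_le_mul_of_one_le_of_one_le
    (one_le_mul_of_one_le_of_one_le (one_le_pow₀ hHr) hS) hA
  have hn0 : (0 : ℝ) < n := by exact_mod_cast hn
  have hκ0 : (0 : ℝ) < κ := by exact_mod_cast pos_iff_ne_zero.2 hκ
  set L := Real.log (4 * N / (p * ε)) with hL
  have hpε : 0 < p * ε := mul_pos hp hε
  have hpε1 : p * ε ≤ 1 := mul_le_one₀ hp1.le hε.le hε1
  have hL0 : 0 ≤ L := Real.log_nonneg <| (one_le_div hpε).2 (by linarith)
  have hLexp : Real.exp (-L) = p * ε / (4 * N) := by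
    rw [Real.exp_neg, hL, Real.exp_log (by positivity), inv_div]
  set δ := (κ : ℝ) * H * √(L / n) with hδ
  have hδ0 : 0 ≤ δ := by positivity
  have hexp : 2 * n * δ ^ 2 / ((κ : ℝ) * H) ^ 2 = 2 * L := by
    rw [hδ, mul_pow, Real.sq_sqrt (by positivity)]
    field_simp
  have h1 := measure_compl_backupsWithin_le (ε := ε) (δ := δ) hU hn hX hδ0 hε hε1
  rw [hexp, probReal_compl_eq_one_sub (measurableSet_backupsWithin hU hX)] at h1
  -- One factor `exp (-L)` is dropped, as `L ≥ 0`; the other already brings the failure probability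
  -- down to `p / 2`.
  have h2 : N / ε * (2 * Real.exp (-(2 * L))) ≤ N / ε * (2 * Real.exp (-L)) := by
    have : Real.exp (-(2 * L)) ≤ Real.exp (-L) := Real.exp_le_exp.2 (by linarith)
    gcongr
  have h3 : N / ε * (2 * Real.exp (-L)) = p / 2 := by
    rw [hLexp]
    field_simp
    norm_num
  rw [← ofReal_measureReal]
  exact ENNReal.ofReal_le_ofReal (by linarith)

end GoodEvent

end

theorem theorem3 :
    ∃ C : ℝ, 0 < C ∧
      ∀ (S : Type u) (A : Type v) [Fintype S] [MeasurableSpace S] [DiscreteMeasurableSpace S]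
        [Fintype A] [Nonempty A] [MeasurableSpace A] [DiscreteMeasurableSpace A]
        (H : ℕ) (M : RSMDP S A H) (κ : ℝ≥0) (_ : LipschitzOnWith κ M.U (Icc (0 : ℝ) H))
        (πstar : MarkovPolicy S A) (_ : IsOptimalPolicy M πstar)
        (ε p : ℝ) (_ : 0 < ε) (_ : 0 < p) (_ : p < 1) (n : ℕ) (_ : 1 ≤ n)
        (Ω : Type w) [MeasurableSpace Ω] (μ : Measure Ω) [IsProbabilityMeasure μ]
        (X : S → A → ℕ → Fin n → Ω → S × ℝ) (_ : IsSimulated M μ X),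
        ∃ E : Set Ω, MeasurableSet E ∧ ENNReal.ofReal (1 - p) ≤ μ E ∧
          ∀ ω ∈ E, ∀ πhat : GridPolicy S A ε,
            IsVIGUPolicy M.U H (fun s a h i => X s a h i ω) πhat →
            ∀ h ∈ Icc 1 H,
              valueDist M πstar (interpolate πhat) h ≤
                ENNReal.ofReal (C * (H * κ * ε + (H : ℝ) ^ 3 * κ *
                  √(Real.log (4 * (H : ℝ) ^ 2 * Fintype.card S * Fintype.card A / (p * ε)) / n))) := by
  refine ⟨6, by norm_num, ?_⟩
  intro S A _ _ _ _ _ _ _ H M κ hU πstar hopt ε p hε hp hp1 n hn Ω _ μ _ X hX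
  -- In these cases no sampling argument is needed. For `ε ≥ 1` the a priori bound `H * κ` is at
  -- most `H * κ * ε`, which also covers a negative logarithm; for `κ = 0` it vanishes; the other
  -- two cases are vacuous.
  by_cases htriv : κ = 0 ∨ 1 ≤ ε ∨ IsEmpty S ∨ H = 0
  · refine ⟨univ, MeasurableSet.univ, ?_, ?_⟩
    · rw [measure_univ]
      exact ENNReal.ofReal_le_one.2 (by linarith)
    · intro ω _ πhat _ h hh
      refine iSup_le fun s => iSup_le fun y => iSup_le fun hy => ENNReal.ofReal_le_ofReal ?_
      refine (abs_value_sub_le_of_lipschitz hU πstar (interpolate πhat) hh s hy).trans ?_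
      have h0 : 0 ≤ (H : ℝ) ^ 3 * κ * √(Real.log (4 * (H : ℝ) ^ 2 * Fintype.card S *
          Fintype.card A / (p * ε)) / n) := by positivity
      have h1 : (0 : ℝ) ≤ H * κ := by positivity
      rcases htriv with rfl | hε1 | hS | rfl
      · simp
      · have h2 := mul_le_mul_of_nonneg_left hε1 h1
        linarith
      · exact (hS.false s).elim
      · exact absurd (hh.1.trans hh.2) (by norm_num)
  · push Not at htriv
    obtain ⟨hκ, hε1, hS, hH⟩ := htriv
    have hH1 : 1 ≤ H := Nat.one_le_iff_ne_zero.2 hH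
    -- The event concerns only the samples, so it serves every way of breaking ties.
    refine ⟨_, measurableSet_backupsWithin hU hX,
      measure_backupsWithin_ge hU hn hX hε hε1.le hκ hH1 hp hp1, ?_⟩
    intro ω hω πhat hπ h hh
    refine iSup_le fun s => iSup_le fun y => iSup_le fun hy => ENNReal.ofReal_le_ofReal ?_
    refine (abs_value_sub_le hU hopt hε (by positivity) hn hω hπ hh s hy).trans ?_
    have h0 : 0 ≤ (H : ℝ) ^ 3 * κ * √(Real.log (4 * (H : ℝ) ^ 2 * Fintype.card S *
          Fintype.card A / (p * ε)) / n) := by positivity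
    linarith
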